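/- Let $G$ be a (finite-dimensional, real) Lie group with Lie algebra $\mathcal G$, and let $U$ be a unitary representation of $G$ on a separable complex Hilbert space $\mathcal H$ (a homomorphism into the unitary operators such that $g\mapsto U(g)\phi$ is continuous for every $\phi\in\mathcal H$). Let $\mathcal D^\infty(U)$ be the space of $C^\infty$-vectors, i.e. of those $\phi$ for which $g\mapsto U(g)\phi$ is a $C^\infty$ map, and let $dU$ be the infinitesimal representation on $\mathcal D^\infty(U)$ of the enveloping algebra $\mathcal E(\mathcal G)$ of the complexification of $\mathcal G$, that is, the extension to an algebra homomorphism of $dU(x)\phi=\frac{d}{dt}U(\exp tx)\phi|_{t=0}$, $x\in\mathcal G$. Put $\mathcal M=dU(\mathcal E(\mathcal G))$, an algebra of operators from $\mathcal D^\infty(U)$ to itself. Let $\mathcal T_1(\mathcal M)$ be the set of trace class operators $\hat T$ on $\mathcal H$ with $\hat T\mathcal H\subset\mathcal D^\infty(U)$, $\hat T^*\mathcal H\subset\mathcal D^\infty(U)$ and such that $\hat A\hat T$ and $\hat A\hat T^*$ are trace class for all $\hat A\in\mathcal M$. Let the state space $\mathcal E_S(\mathcal M)$ be the set of all positive (hence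 self-adjoint) $\hat\rho\in\mathcal T_1(\mathcal M)$ with $\mathrm{Tr}\,\hat\rho=1$, with the weak topology generated by the functions $\hat\rho\mapsto \mathrm{Tr}\,\hat A\hat\rho$, $\hat A\in\mathcal M$. Let $\hat A\in\mathcal M$ be essentially self-adjoint on $\mathcal D^\infty(U)$, and let $W$ be a nonempty open subset of $\mathcal E_S(\mathcal M)$. If the qr-number $a_Q(W)$, i.e. the function $\hat\rho\mapsto \mathrm{Tr}\,\hat A\hat\rho$ on $W$, is identically $0$, then $\hat A$ is the zero operator on $\mathcal D^\infty(U)$. -/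

import Mathlib

open scoped Manifold ContDiff InnerProductSpace TensorProduct
open VectorField

/-- The derivative at `x`, in the direction `v`, of a vector-valued function on a manifold. -/
noncomputable def dirDeriv {E : Type*} [NormedAddCommGroup E] [NormedSpace ℝ E]
    {M : Type*} [TopologicalSpace M] [ChartedSpace E M]
    {F : Type*} [NormedAddCommGroup F] [NormedSpace ℝ F]
    (f : M → F) (x : M) (v : TangentSpace 𝓘(ℝ, E) x) : F :=
  mfderiv 𝓘(ℝ, E) 𝓘(ℝ, F) f x v

lemma dirDeriv_clm_comp {E : Type*} [NormedAddCommGroup E] [NormedSpace ℝ E]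
    {M : Type*} [TopologicalSpace M] [ChartedSpace E M]
    {F F' : Type*} [NormedAddCommGroup F] [NormedSpace ℝ F]
    [NormedAddCommGroup F'] [NormedSpace ℝ F'] (L : F →L[ℝ] F')
    {f : M → F} {x : M} (hf : MDifferentiableAt 𝓘(ℝ, E) 𝓘(ℝ, F) f x)
    (v : TangentSpace 𝓘(ℝ, E) x) :
    dirDeriv (fun y ↦ L (f y)) x v = L (dirDeriv f x v) := by
  have h := mfderiv_comp x (L.differentiableAt.mdifferentiableAt) hf
  rw [mfderiv_eq_fderiv, L.fderiv] at h
  exact congrArg (fun T ↦ T v) h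

lemma inTangentCoordinates_const_left {E : Type*} [NormedAddCommGroup E] [NormedSpace ℝ E]
    {M : Type*} [TopologicalSpace M] [ChartedSpace E M] [IsManifold 𝓘(ℝ, E) 1 M]
    {F : Type*} [NormedAddCommGroup F] [NormedSpace ℝ F] {N : Type*} (m : M) (k : N → F)
    (ψ : N → E →L[ℝ] F) (y₀ y : N) :
    inTangentCoordinates 𝓘(ℝ, E) 𝓘(ℝ, F) (fun _ ↦ m) k ψ y₀ y = ψ y := by
  rw [inTangentCoordinates_eq (x₀ := y₀) (x := y) _ _ _ (mem_chart_source _ _)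
    (by rw [chartAt_self_eq]; trivial)]
  ext v
  have h1 : (tangentBundleCore 𝓘(ℝ, E) M).coordChange (achart E m) (achart E m) m v = v :=
    (tangentBundleCore 𝓘(ℝ, E) M).coordChange_self (achart E m) m (mem_achart_source E m) v
  have h2 : ∀ w, (tangentBundleCore 𝓘(ℝ, F) F).coordChange (achart F (k y)) (achart F (k y₀))
      (k y) w = w :=
    fun w ↦ (tangentBundleCore 𝓘(ℝ, F) F).coordChange_self (achart F (k y)) (k y)
      (mem_achart_source F (k y)) w
  rw [ContinuousLinearMap.comp_apply, ContinuousLinearMap.comp_apply, h1, h2]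

/-- The Lie bracket of vector fields acts on smooth functions as the commutator. -/
lemma dirDeriv_mlieBracket {E : Type*} [NormedAddCommGroup E] [NormedSpace ℝ E]
    [CompleteSpace E] {M : Type*} [TopologicalSpace M] [ChartedSpace E M]
    [IsManifold 𝓘(ℝ, E) ∞ M] {F : Type*} [NormedAddCommGroup F] [NormedSpace ℝ F]
    {f : M → F} (hf : ContMDiff 𝓘(ℝ, E) 𝓘(ℝ, F) ∞ f)
    (V W : (x : M) → TangentSpace 𝓘(ℝ, E) x) (x : M)
    (hV : MDifferentiableAt 𝓘(ℝ, E) 𝓘(ℝ, E).tangent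
      (fun y ↦ (⟨y, V y⟩ : TangentBundle 𝓘(ℝ, E) M)) x)
    (hW : MDifferentiableAt 𝓘(ℝ, E) 𝓘(ℝ, E).tangent
      (fun y ↦ (⟨y, W y⟩ : TangentBundle 𝓘(ℝ, E) M)) x)
    (hgV : MDifferentiableAt 𝓘(ℝ, E) 𝓘(ℝ, F) (fun y ↦ dirDeriv f y (V y)) x)
    (hgW : MDifferentiableAt 𝓘(ℝ, E) 𝓘(ℝ, F) (fun y ↦ dirDeriv f y (W y)) x) :
    dirDeriv f x (mlieBracket 𝓘(ℝ, E) V W x) =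
      dirDeriv (fun y ↦ dirDeriv f y (W y)) x (V x) -
        dirDeriv (fun y ↦ dirDeriv f y (V y)) x (W x) := by
  have : IsManifold 𝓘(ℝ, E) 2 M := inferInstance
  have : IsManifold 𝓘(ℝ, E) 1 M := inferInstance
  set e := extChartAt 𝓘(ℝ, E) x with he
  let P (Z : (x : M) → TangentSpace 𝓘(ℝ, E) x) : E → E :=
    mpullbackWithin 𝓘(ℝ, E) 𝓘(ℝ, E) e.symm Z (Set.range 𝓘(ℝ, E))
  have dP (Z : (x : M) → TangentSpace 𝓘(ℝ, E) x)
      (hZ : MDifferentiableAt 𝓘(ℝ, E) 𝓘(ℝ, E).tangent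
      (fun y ↦ (⟨y, Z y⟩ : TangentBundle 𝓘(ℝ, E) M)) x) : DifferentiableAt ℝ (P Z) (e x) := by
    have := MDifferentiableWithinAt.differentiableWithinAt_mpullbackWithin_vectorField
      (s := Set.univ) (V := Z) hZ.mdifferentiableWithinAt
    rw [Set.preimage_univ, Set.univ_inter] at this
    exact this.differentiableAt (by simp)
  set ft : E → F := f ∘ e.symm with hft
  have hx : e x ∈ e.target := mem_extChartAt_target x
  have hxx : e.symm (e x) = x := extChartAt_to_inv x
  have hsymm : ContMDiffOn 𝓘(ℝ, E) 𝓘(ℝ, E) ∞ e.symm e.target := contMDiffOn_extChartAt_symm x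
  have hopen : IsOpen e.target := isOpen_extChartAt_target x
  have cft : ContDiffOn ℝ ∞ ft e.target :=
    (hf.comp_contMDiffOn hsymm).contDiffOn
  -- chain rule at the points of the chart
  have key : ∀ (g : M → F) (Z : (x : M) → TangentSpace 𝓘(ℝ, E) x), ∀ u ∈ e.target,
      MDifferentiableAt 𝓘(ℝ, E) 𝓘(ℝ, F) g (e.symm u) →
      dirDeriv g (e.symm u) (Z (e.symm u)) = fderiv ℝ (g ∘ e.symm) u (P Z u) := by
    intro g Z u hu hg
    have h1 : MDifferentiableAt 𝓘(ℝ, E) 𝓘(ℝ, E) e.symm u :=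
      ((hsymm u hu).contMDiffAt (hopen.mem_nhds hu)).mdifferentiableAt (by simp)
    have h2 := mfderiv_comp u hg h1
    have h4 : mfderivWithin 𝓘(ℝ, E) 𝓘(ℝ, E) e.symm (Set.range 𝓘(ℝ, E)) u =
        mfderiv 𝓘(ℝ, E) 𝓘(ℝ, E) e.symm u := by
      rw [modelWithCornersSelf_coe, Set.range_id, mfderivWithin_univ]
    obtain ⟨A, hA⟩ := isInvertible_mfderivWithin_extChartAt_symm hu
    rw [← he, h4] at hA
    have h5 : P Z u = A.symm (Z (e.symm u)) := by
      change mpullbackWithin 𝓘(ℝ, E) 𝓘(ℝ, E) e.symm Z (Set.range 𝓘(ℝ, E)) u = _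
      rw [mpullbackWithin_apply, h4, ← hA, ContinuousLinearMap.inverse_equiv]
      rfl
    rw [← mfderiv_eq_fderiv, h2, h5, ← hA]
    change _ = mfderiv 𝓘(ℝ, E) 𝓘(ℝ, F) g (e.symm u) (A (A.symm (Z (e.symm u))))
    rw [A.apply_symm_apply]
    rfl
  have hfd : ∀ y, MDifferentiableAt 𝓘(ℝ, E) 𝓘(ℝ, F) f y := fun y ↦ hf.mdifferentiableAt (by simp)
  have h2d : ContDiffAt ℝ ∞ ft (e x) := cft.contDiffAt (hopen.mem_nhds hx)
  have hdd : DifferentiableAt ℝ (fderiv ℝ ft) (e x) :=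
    (h2d.fderiv_right (m := 1) (by norm_cast)).differentiableAt (by simp)
  have hsym : IsSymmSndFDerivAt ℝ ft (e x) := h2d.isSymmSndFDerivAt
    (by rw [minSmoothness_of_isRCLikeNormedField]; norm_cast)
  -- second derivatives
  have step : ∀ (Y Z : (x : M) → TangentSpace 𝓘(ℝ, E) x),
      MDifferentiableAt 𝓘(ℝ, E) 𝓘(ℝ, F) (fun y ↦ dirDeriv f y (Z y)) x →
      DifferentiableAt ℝ (P Z) (e x) →
      dirDeriv (fun y ↦ dirDeriv f y (Z y)) x (Y x) =
        fderiv ℝ (fderiv ℝ ft) (e x) (P Y (e x)) (P Z (e x)) +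
          fderiv ℝ ft (e x) (fderiv ℝ (P Z) (e x) (P Y (e x))) := by
    intro Y Z hg hZ
    have h := key (fun y ↦ dirDeriv f y (Z y)) Y (e x) hx (by rwa [hxx])
    rw [hxx] at h
    rw [h]
    have hev : ((fun y ↦ dirDeriv f y (Z y)) ∘ e.symm) =ᶠ[nhds (e x)]
        fun u ↦ fderiv ℝ ft u (P Z u) := by
      filter_upwards [hopen.mem_nhds hx] with u hu
      exact key f Z u hu (hfd _)
    rw [hev.fderiv_eq, fderiv_clm_apply hdd hZ]
    simp [add_comm]
  set B : E := lieBracket ℝ (P V) (P W) (e x) with hB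
  have h0 : dirDeriv f x (mlieBracket 𝓘(ℝ, E) V W x) =
      fderiv ℝ ft (e x) B := by
    have h1 : f =ᶠ[nhds x] ft ∘ e := by
      filter_upwards [extChartAt_source_mem_nhds (I := 𝓘(ℝ, E)) x] with y hy
      change f y = f (e.symm (e y))
      rw [e.left_inv hy]
    have h2 : MDifferentiableAt 𝓘(ℝ, E) 𝓘(ℝ, F) ft (e x) :=
      (h2d.differentiableAt (by simp)).mdifferentiableAt
    have h3 : MDifferentiableAt 𝓘(ℝ, E) 𝓘(ℝ, E) e x :=
      mdifferentiableAt_extChartAt (mem_chart_source E x)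
    obtain ⟨A, hA⟩ := isInvertible_mfderiv_extChartAt (I := 𝓘(ℝ, E))
      (mem_extChartAt_source (I := 𝓘(ℝ, E)) x)
    rw [← he] at hA
    have h5 : mlieBracket 𝓘(ℝ, E) V W x = A.symm B := by
      rw [← mlieBracketWithin_univ, mlieBracketWithin_apply, ← he, ← hA,
        ContinuousLinearMap.inverse_equiv, Set.preimage_univ, Set.univ_inter]
      rw [hB, ← lieBracketWithin_univ, ← Set.range_id, ← modelWithCornersSelf_coe ℝ E]
      rfl
    have h6 : mfderiv 𝓘(ℝ, E) 𝓘(ℝ, F) (ft ∘ e) x =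
        (mfderiv 𝓘(ℝ, E) 𝓘(ℝ, F) ft (e x)).comp (mfderiv 𝓘(ℝ, E) 𝓘(ℝ, E) e x) :=
      mfderiv_comp x h2 h3
    have h7 : dirDeriv f x (mlieBracket 𝓘(ℝ, E) V W x) =
        dirDeriv (ft ∘ e) x (mlieBracket 𝓘(ℝ, E) V W x) := by
      unfold dirDeriv
      rw [h1.mfderiv_eq]
      rfl
    rw [h7, h5, ← mfderiv_eq_fderiv]
    unfold dirDeriv
    rw [h6, ← hA]
    change mfderiv 𝓘(ℝ, E) 𝓘(ℝ, F) ft (e x) (A (A.symm B)) = _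
    exact congrArg (mfderiv 𝓘(ℝ, E) 𝓘(ℝ, F) ft (e x)) (A.apply_symm_apply B)
  rw [h0, step V W hgW (dP W hW), step W V hgV (dP V hV), hB, lieBracket, map_sub,
    hsym.eq]
  abel

instance instLieGroupThree {E : Type*} [NormedAddCommGroup E] [NormedSpace ℝ E]
    {G : Type*} [TopologicalSpace G] [ChartedSpace E G] [Group G]
    [LieGroup 𝓘(ℝ, E) ∞ G] : LieGroup 𝓘(ℝ, E) (minSmoothness ℝ 3) G := by
  rw [minSmoothness_of_isRCLikeNormedField]
  infer_instance

section LieExp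

variable {E : Type*} [NormedAddCommGroup E] [NormedSpace ℝ E]
  {G : Type*} [TopologicalSpace G] [ChartedSpace E G] [Group G]
  [LieGroup 𝓘(ℝ, E) ∞ G]

lemma contMDiff_one_mulInvariantVectorField (x : GroupLieAlgebra 𝓘(ℝ, E) G) :
    ContMDiff 𝓘(ℝ, E) 𝓘(ℝ, E).tangent 1
      (fun g : G ↦ (⟨g, mulInvariantVectorField x g⟩ : TangentBundle 𝓘(ℝ, E) G)) :=
  (contMDiff_mulInvariantVectorField x).of_le
    (le_trans (by norm_num) le_minSmoothness)

lemma mfderiv_mul_left_mulInvariantVectorField (x : GroupLieAlgebra 𝓘(ℝ, E) G) (g h : G) :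
    mfderiv 𝓘(ℝ, E) 𝓘(ℝ, E) (fun k : G ↦ g * k) h (mulInvariantVectorField x h) =
      mulInvariantVectorField x (g * h) := by
  have M : (∞ : ℕ∞ω) ≠ 0 := by simp
  have hd (a b : G) : MDifferentiableAt 𝓘(ℝ, E) 𝓘(ℝ, E) (fun k : G ↦ a * k) b :=
    (contMDiff_mul_left (I := 𝓘(ℝ, E)) (n := ∞)).contMDiffAt.mdifferentiableAt M
  have h1 : (fun k : G ↦ g * h * k) = (fun k ↦ g * k) ∘ (fun k ↦ h * k) := by
    ext k; simp [mul_assoc]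
  have h2 : mfderiv 𝓘(ℝ, E) 𝓘(ℝ, E) (fun k : G ↦ g * h * k) 1 =
      (mfderiv 𝓘(ℝ, E) 𝓘(ℝ, E) (fun k : G ↦ g * k) (h * 1)).comp
        (mfderiv 𝓘(ℝ, E) 𝓘(ℝ, E) (fun k : G ↦ h * k) 1) := by
    rw [h1]; exact mfderiv_comp (1 : G) (hd g (h * 1)) (hd h 1)
  have h3 : ∀ a b : G, a = b → ∀ v : E,
      (show E from mfderiv 𝓘(ℝ, E) 𝓘(ℝ, E) (fun k : G ↦ g * k) a v) =
        (show E from mfderiv 𝓘(ℝ, E) 𝓘(ℝ, E) (fun k : G ↦ g * k) b v) := by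
    rintro a _ rfl v; rfl
  unfold mulInvariantVectorField
  rw [h2]
  exact (h3 (h * 1) h (mul_one h) _).symm

variable [CompleteSpace E] [T2Space G]

lemma exists_isMIntegralCurve_mulInvariantVectorField (x : GroupLieAlgebra 𝓘(ℝ, E) G) :
    ∃ γ : ℝ → G, γ 0 = 1 ∧ IsMIntegralCurve (I := 𝓘(ℝ, E)) γ (mulInvariantVectorField x) := by
  have : IsManifold 𝓘(ℝ, E) 1 G := inferInstance
  have hX := contMDiff_one_mulInvariantVectorField (E := E) (G := G) x
  obtain ⟨γ, h0, hγ⟩ :=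
    exists_isMIntegralCurveAt_of_contMDiffAt_boundaryless (I := 𝓘(ℝ, E)) 0 (hX 1)
  obtain ⟨ε, hε, hγ⟩ := isMIntegralCurveAt_iff'.1 hγ
  refine exists_isMIntegralCurve_of_isMIntegralCurveOn hX hε (fun g ↦ ⟨fun t ↦ g * γ t, ?_, ?_⟩) 1
  · simp [h0]
  · intro t ht
    rw [Real.ball_eq_Ioo, zero_sub, zero_add] at hγ
    have h1 := hγ t ht
    have hd : MDifferentiableAt 𝓘(ℝ, E) 𝓘(ℝ, E) (fun k : G ↦ g * k) (γ t) :=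
      (contMDiff_mul_left (I := 𝓘(ℝ, E)) (n := ∞)).contMDiffAt.mdifferentiableAt (by simp)
    have h2 := hd.hasMFDerivAt.comp_hasMFDerivWithinAt t h1
    have h3 : (mfderiv 𝓘(ℝ, E) 𝓘(ℝ, E) (fun k : G ↦ g * k) (γ t)).comp
        (ContinuousLinearMap.smulRight (1 : ℝ →L[ℝ] ℝ) (mulInvariantVectorField x (γ t))) =
        ContinuousLinearMap.smulRight (1 : ℝ →L[ℝ] ℝ) (mulInvariantVectorField x (g * γ t)) := by
      rw [← mfderiv_mul_left_mulInvariantVectorField]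
      exact ContinuousLinearMap.ext fun r ↦
        (mfderiv 𝓘(ℝ, E) 𝓘(ℝ, E) (fun k : G ↦ g * k) (γ t)).map_smul r _
    exact h3 ▸ h2

/-- The one-parameter subgroup `t ↦ exp (t x)` of `G`: the integral curve through the identity of
the left-invariant vector field with value `x` at the identity. -/
noncomputable def oneParam (x : GroupLieAlgebra 𝓘(ℝ, E) G) : ℝ → G :=
  Classical.choose (exists_isMIntegralCurve_mulInvariantVectorField x)

lemma oneParam_zero (x : GroupLieAlgebra 𝓘(ℝ, E) G) : oneParam x 0 = 1 :=
  (Classical.choose_spec (exists_isMIntegralCurve_mulInvariantVectorField x)).1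

lemma isMIntegralCurve_oneParam (x : GroupLieAlgebra 𝓘(ℝ, E) G) :
    IsMIntegralCurve (I := 𝓘(ℝ, E)) (oneParam x) (mulInvariantVectorField x) :=
  (Classical.choose_spec (exists_isMIntegralCurve_mulInvariantVectorField x)).2

/-- The exponential map of the Lie group `G`. -/
noncomputable def lieExp (x : GroupLieAlgebra 𝓘(ℝ, E) G) : G := oneParam x 1

lemma lieExp_smul (t : ℝ) (x : GroupLieAlgebra 𝓘(ℝ, E) G) : lieExp (t • x) = oneParam x t := by
  have h1 := (isMIntegralCurve_oneParam x).comp_mul t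
  rw [← mulInvariantVectorField_smul] at h1
  have h2 := isMIntegralCurve_Ioo_eq_of_contMDiff_boundaryless (t₀ := 0)
    (contMDiff_one_mulInvariantVectorField (t • x)) h1 (isMIntegralCurve_oneParam (t • x))
    (by simp [oneParam_zero])
  have := congrFun h2 1
  simpa [lieExp] using this.symm
end LieExp

section Complexify

attribute [local instance] LieRing.ofAssociativeRing

/-- The complex-linear extension to `ℂ ⊗ L` of a homomorphism from a real Lie algebra `L` to a
complex associative algebra. -/
noncomputable def complexifyLieHom {L A : Type*} [LieRing L] [LieAlgebra ℝ L] [Ring A]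
    [Algebra ℂ A] [Algebra ℝ A] [IsScalarTower ℝ ℂ A] (f : L →ₗ⁅ℝ⁆ A) : (ℂ ⊗[ℝ] L) →ₗ⁅ℂ⁆ A where
  __ := LinearMap.liftBaseChange ℂ (f : L →ₗ[ℝ] A)
  map_lie' := by
    intro a b
    change LinearMap.liftBaseChange ℂ (f : L →ₗ[ℝ] A) ⁅a, b⁆ =
      ⁅LinearMap.liftBaseChange ℂ (f : L →ₗ[ℝ] A) a, LinearMap.liftBaseChange ℂ (f : L →ₗ[ℝ] A) b⁆
    have h0 : ⁅a, (0 : ℂ ⊗[ℝ] L)⁆ = 0 := lie_zero a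
    have h1 : ∀ b₁ b₂ : ℂ ⊗[ℝ] L, ⁅a, b₁ + b₂⁆ = ⁅a, b₁⁆ + ⁅a, b₂⁆ := lie_add a
    induction b with
    | zero => rw [h0, map_zero, lie_zero]
    | add b₁ b₂ h₁ h₂ => rw [h1, map_add, map_add, lie_add, h₁, h₂]
    | tmul s y =>
      clear h0 h1
      induction a with
      | zero => rw [zero_lie, map_zero, zero_lie]
      | add a₁ a₂ h₁ h₂ => rw [add_lie, map_add, map_add, add_lie, h₁, h₂]
      | tmul r x =>
        rw [LieAlgebra.ExtendScalars.bracket_tmul]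
        simp [LieRing.of_associative_ring_bracket, smul_sub, mul_smul, smul_comm s r]

lemma complexifyLieHom_tmul {L A : Type*} [LieRing L] [LieAlgebra ℝ L] [Ring A]
    [Algebra ℂ A] [Algebra ℝ A] [IsScalarTower ℝ ℂ A] (f : L →ₗ⁅ℝ⁆ A) (c : ℂ) (x : L) :
    complexifyLieHom f (c ⊗ₜ[ℝ] x) = c • f x :=
  LinearMap.liftBaseChange_tmul _ _ _ _

end Complexify

/-- A unitary representation of the topological group `G` on the Hilbert space `H`: a homomorphism
into the unitary operators such that all orbit maps `g ↦ U(g) φ` are continuous. -/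
structure UnitaryRep (G : Type*) [Group G] [TopologicalSpace G]
    (H : Type*) [NormedAddCommGroup H] [InnerProductSpace ℂ H] [CompleteSpace H] where
  toMonoidHom : G →* unitary (H →L[ℂ] H)
  continuous_orbit : ∀ φ : H, Continuous fun g : G ↦ (toMonoidHom g : H →L[ℂ] H) φ

namespace UnitaryRep

section Basic

variable {G : Type*} [TopologicalSpace G] [Group G]
  {H : Type*} [NormedAddCommGroup H] [InnerProductSpace ℂ H] [CompleteSpace H]

/-- The operator `U(g)`. -/
noncomputable def op (U : UnitaryRep G H) (g : G) : H →L[ℂ] H := U.toMonoidHom g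

lemma op_mul (U : UnitaryRep G H) (g h : G) (φ : H) : U.op (g * h) φ = U.op g (U.op h φ) := by
  simp [op]

lemma op_one (U : UnitaryRep G H) (φ : H) : U.op 1 φ = φ := by
  simp [op]

/-- The space `D^∞(U)` of smooth vectors: those `φ` for which `g ↦ U(g) φ` is a `C^∞` map from `G`
(a manifold modelled on `E`) to `H`. -/
noncomputable def smoothVectors (E : Type*) [NormedAddCommGroup E] [NormedSpace ℝ E]
    [ChartedSpace E G] (U : UnitaryRep G H) : Submodule ℂ H where
  carrier := {φ | ContMDiff 𝓘(ℝ, E) 𝓘(ℝ, H) ∞ fun g : G ↦ U.op g φ}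
  zero_mem' := by simpa using contMDiff_const
  add_mem' := by
    intro φ ψ hφ hψ
    have h := ContMDiff.add (show ContMDiff 𝓘(ℝ, E) 𝓘(ℝ, H) ∞ fun g : G ↦ U.op g φ from hφ)
      (show ContMDiff 𝓘(ℝ, E) 𝓘(ℝ, H) ∞ fun g : G ↦ U.op g ψ from hψ)
    simpa [Pi.add_def] using h
  smul_mem' := by
    intro c φ hφ
    have h1 : ContMDiff 𝓘(ℝ, H) 𝓘(ℝ, H) ∞ fun v : H ↦ c • v :=
      (contDiff_const_smul c).contMDiff
    have h := h1.comp (show ContMDiff 𝓘(ℝ, E) 𝓘(ℝ, H) ∞ fun g : G ↦ U.op g φ from hφ)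
    simpa [Function.comp_def] using h

end Basic

section Infinitesimal

variable {E : Type*} [NormedAddCommGroup E] [NormedSpace ℝ E]
  {G : Type*} [TopologicalSpace G] [ChartedSpace E G] [Group G]
  {H : Type*} [NormedAddCommGroup H] [InnerProductSpace ℂ H] [CompleteSpace H]
  (U : UnitaryRep G H)

lemma op_dirDeriv_one {φ : H} (hφ : φ ∈ U.smoothVectors E) (x : GroupLieAlgebra 𝓘(ℝ, E) G)
    (g : G) :
    U.op g (dirDeriv (fun h ↦ U.op h φ) 1 x) = dirDeriv (fun h ↦ U.op (g * h) φ) 1 x := by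
  have hφ' : ContMDiff 𝓘(ℝ, E) 𝓘(ℝ, H) ∞ fun g : G ↦ U.op g φ := hφ
  simp_rw [op_mul]
  exact (dirDeriv_clm_comp ((U.op g).restrictScalars ℝ)
    (hφ'.mdifferentiableAt (by simp)) x).symm

variable [LieGroup 𝓘(ℝ, E) ∞ G]

lemma op_dirDeriv {φ : H} (hφ : φ ∈ U.smoothVectors E) (x : GroupLieAlgebra 𝓘(ℝ, E) G) (g : G) :
    U.op g (dirDeriv (fun h ↦ U.op h φ) 1 x) =
      dirDeriv (fun h ↦ U.op h φ) g (mulInvariantVectorField x g) := by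
  have hφ' : ContMDiff 𝓘(ℝ, E) 𝓘(ℝ, H) ∞ fun g : G ↦ U.op g φ := hφ
  have hd : ∀ a : G, MDifferentiableAt 𝓘(ℝ, E) 𝓘(ℝ, H) (fun g : G ↦ U.op g φ) a :=
    fun a ↦ hφ'.mdifferentiableAt (by simp)
  have hm : MDifferentiableAt 𝓘(ℝ, E) 𝓘(ℝ, E) (fun k : G ↦ g * k) 1 :=
    (contMDiff_mul_left (I := 𝓘(ℝ, E)) (n := ∞)).contMDiffAt.mdifferentiableAt (by simp)
  have h3 := mfderiv_comp (1 : G) (hd (g * 1)) hm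
  have h4 : ∀ a b : G, a = b → ∀ v : E,
      dirDeriv (fun h ↦ U.op h φ) a v = dirDeriv (fun h ↦ U.op h φ) b v := by
    rintro a _ rfl v; rfl
  rw [op_dirDeriv_one U hφ]
  refine Eq.trans ?_ (h4 (g * 1) g (mul_one g) _)
  exact congrArg (fun T ↦ T x) h3

lemma dirDeriv_mem_smoothVectors {φ : H} (hφ : φ ∈ U.smoothVectors E)
    (x : GroupLieAlgebra 𝓘(ℝ, E) G) :
    dirDeriv (fun h ↦ U.op h φ) 1 x ∈ U.smoothVectors E := by
  have hφ' : ContMDiff 𝓘(ℝ, E) 𝓘(ℝ, H) ∞ fun g : G ↦ U.op g φ := hφ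
  change ContMDiff 𝓘(ℝ, E) 𝓘(ℝ, H) ∞ fun g : G ↦ U.op g (dirDeriv (fun h ↦ U.op h φ) 1 x)
  simp_rw [op_dirDeriv_one U hφ]
  have : IsManifold 𝓘(ℝ, E) 1 G := inferInstance
  intro g₀
  have hf : ContMDiff (𝓘(ℝ, E).prod 𝓘(ℝ, E)) 𝓘(ℝ, H) ∞
      (Function.uncurry fun g h : G ↦ U.op (g * h) φ) :=
    hφ'.comp (contMDiff_mul 𝓘(ℝ, E) ∞)
  have h := ContMDiffAt.mfderiv_apply (m := ∞) (n := ∞) (I := 𝓘(ℝ, E)) (J := 𝓘(ℝ, E))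
    (J' := 𝓘(ℝ, E)) (I' := 𝓘(ℝ, H)) (x₀ := g₀)
    (fun g h : G ↦ U.op (g * h) φ) (fun _ ↦ 1) id (fun _ ↦ (x : E))
    hf.contMDiffAt contMDiffAt_const contMDiffAt_id contMDiffAt_const le_rfl
  refine h.congr_of_eventuallyEq (Filter.Eventually.of_forall fun g ↦ ?_)
  let ψ : G → E →L[ℝ] H := fun g ↦ mfderiv 𝓘(ℝ, E) 𝓘(ℝ, H) (fun h : G ↦ U.op (g * h) φ) 1
  have h2 := inTangentCoordinates_const_left (1 : G) (fun g : G ↦ U.op (g * 1) φ) ψ g₀ g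
  exact (DFunLike.congr_fun h2 (show E from x)).symm

variable [CompleteSpace E] [T2Space G]

/-- The derivative at `t = 0` of `t ↦ U(exp (t x)) φ`. -/
noncomputable def lieDeriv (x : GroupLieAlgebra 𝓘(ℝ, E) G) (φ : H) : H :=
  deriv (fun t : ℝ ↦ U.op (lieExp (t • x)) φ) 0

lemma hasDerivAt_op_lieExp (x : GroupLieAlgebra 𝓘(ℝ, E) G) {φ : H} (hφ : φ ∈ U.smoothVectors E) :
    HasDerivAt (fun t : ℝ ↦ U.op (lieExp (t • x)) φ) (dirDeriv (fun g ↦ U.op g φ) 1 x) 0 := by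
  have hφ' : ContMDiff 𝓘(ℝ, E) 𝓘(ℝ, H) ∞ fun g : G ↦ U.op g φ := hφ
  have hd : MDifferentiableAt 𝓘(ℝ, E) 𝓘(ℝ, H) (fun g : G ↦ U.op g φ) (oneParam x 0) :=
    hφ'.mdifferentiableAt (by simp)
  have h2 := hd.hasMFDerivAt.comp (0 : ℝ) (isMIntegralCurve_oneParam x 0)
  let T : ℝ →L[ℝ] H := ContinuousLinearMap.smulRight (1 : ℝ →L[ℝ] ℝ)
    (dirDeriv (fun g : G ↦ U.op g φ) (oneParam x 0) (mulInvariantVectorField x (oneParam x 0)))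
  have h3 : HasMFDerivAt 𝓘(ℝ, ℝ) 𝓘(ℝ, H) ((fun g : G ↦ U.op g φ) ∘ oneParam x) 0 T := by
    refine h2.congr_mfderiv (ContinuousLinearMap.ext fun r ↦ ?_)
    exact (mfderiv 𝓘(ℝ, E) 𝓘(ℝ, H) (fun g : G ↦ U.op g φ) (oneParam x 0)).map_smul r
      (mulInvariantVectorField x (oneParam x 0))
  have h3'' : HasFDerivAt ((fun g : G ↦ U.op g φ) ∘ oneParam x) T 0 := h3.hasFDerivAt
  have h3' := h3''.hasDerivAt
  have h4 : (fun t : ℝ ↦ U.op (lieExp (t • x)) φ) = (fun g ↦ U.op g φ) ∘ oneParam x := by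
    ext t; simp [lieExp_smul]
  have h5 : ∀ a : G, a = 1 → dirDeriv (fun h ↦ U.op h φ) 1 x =
      dirDeriv (fun h ↦ U.op h φ) a (mulInvariantVectorField x a) := by
    rintro _ rfl
    rw [← op_dirDeriv U hφ, op_one]
  rw [h4, h5 _ (oneParam_zero x)]
  simpa [T] using h3'

lemma lieDeriv_eq (x : GroupLieAlgebra 𝓘(ℝ, E) G) {φ : H} (hφ : φ ∈ U.smoothVectors E) :
    U.lieDeriv x φ = dirDeriv (fun g ↦ U.op g φ) 1 x :=
  (U.hasDerivAt_op_lieExp x hφ).deriv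

lemma hasDerivAt_lieDeriv (x : GroupLieAlgebra 𝓘(ℝ, E) G) {φ : H} (hφ : φ ∈ U.smoothVectors E) :
    HasDerivAt (fun t : ℝ ↦ U.op (lieExp (t • x)) φ) (U.lieDeriv x φ) 0 :=
  U.lieDeriv_eq x hφ ▸ U.hasDerivAt_op_lieExp x hφ

lemma lieDeriv_mem (x : GroupLieAlgebra 𝓘(ℝ, E) G) {φ : H} (hφ : φ ∈ U.smoothVectors E) :
    U.lieDeriv x φ ∈ U.smoothVectors E :=
  U.lieDeriv_eq x hφ ▸ U.dirDeriv_mem_smoothVectors hφ x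

lemma lieDeriv_lie (x y : GroupLieAlgebra 𝓘(ℝ, E) G) {φ : H} (hφ : φ ∈ U.smoothVectors E) :
    U.lieDeriv ⁅x, y⁆ φ = U.lieDeriv x (U.lieDeriv y φ) - U.lieDeriv y (U.lieDeriv x φ) := by
  have hφ' : ContMDiff 𝓘(ℝ, E) 𝓘(ℝ, H) ∞ fun g : G ↦ U.op g φ := hφ
  have h1 (z : GroupLieAlgebra 𝓘(ℝ, E) G) :
      (fun g ↦ dirDeriv (fun h ↦ U.op h φ) g (mulInvariantVectorField z g)) =
        fun g ↦ U.op g (U.lieDeriv z φ) := by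
    ext g; rw [← op_dirDeriv U hφ, lieDeriv_eq U z hφ]
  have h2 (z : GroupLieAlgebra 𝓘(ℝ, E) G) : MDifferentiableAt 𝓘(ℝ, E) 𝓘(ℝ, H)
      (fun g ↦ dirDeriv (fun h ↦ U.op h φ) g (mulInvariantVectorField z g)) 1 := by
    rw [h1]
    exact ContMDiff.mdifferentiableAt (n := ∞) (U.lieDeriv_mem z hφ) (by simp)
  have hX (z : GroupLieAlgebra 𝓘(ℝ, E) G) :=
    ((contMDiff_one_mulInvariantVectorField z).contMDiffAt (x := 1)).mdifferentiableAt one_ne_zero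
  have h3 := dirDeriv_mlieBracket hφ' (mulInvariantVectorField x) (mulInvariantVectorField y) 1
    (hX x) (hX y) (h2 x) (h2 y)
  rw [h1, h1] at h3
  have h4 : ∀ z : GroupLieAlgebra 𝓘(ℝ, E) G, mulInvariantVectorField z (1 : G) = z := by
    intro z
    have h5 : (fun k : G ↦ 1 * k) = id := by ext; simp
    unfold mulInvariantVectorField
    have h6 : ∀ f : G → G, f = id → ∀ v : E,
        (show E from mfderiv 𝓘(ℝ, E) 𝓘(ℝ, E) f 1 v) = v := by
      rintro _ rfl v
      rw [mfderiv_id]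
      rfl
    exact h6 _ h5 z
  rw [h4, h4, ← lieDeriv_eq U _ (U.lieDeriv_mem _ hφ), ← lieDeriv_eq U _ (U.lieDeriv_mem _ hφ)] at h3
  rw [← h3, lieDeriv_eq U _ hφ]
  rfl

/-- The operator `dU(x) φ = d/dt U(exp (t x)) φ |_{t = 0}` on `D^∞(U)`. -/
noncomputable def dUOp (x : GroupLieAlgebra 𝓘(ℝ, E) G) : Module.End ℂ (U.smoothVectors E) where
  toFun φ := ⟨U.lieDeriv x φ, U.lieDeriv_mem x φ.2⟩
  map_add' φ ψ := by
    refine Subtype.ext ?_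
    have h := (U.hasDerivAt_lieDeriv x φ.2).add (U.hasDerivAt_lieDeriv x ψ.2)
    refine HasDerivAt.unique (U.hasDerivAt_lieDeriv x (φ + ψ).2) ?_
    simpa [Pi.add_def] using h
  map_smul' c φ := by
    refine Subtype.ext ?_
    have h := (U.hasDerivAt_lieDeriv x φ.2).const_smul c
    refine HasDerivAt.unique (U.hasDerivAt_lieDeriv x (c • φ).2) ?_
    simpa [Pi.smul_def] using h

lemma coe_dUOp (x : GroupLieAlgebra 𝓘(ℝ, E) G) (φ : U.smoothVectors E) :
    (U.dUOp x φ : H) = dirDeriv (fun g ↦ U.op g (φ : H)) 1 x :=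
  U.lieDeriv_eq x φ.2

attribute [local instance] LieRing.ofAssociativeRing

/-- The representation `x ↦ dU(x)` of the real Lie algebra of `G` on the smooth vectors. -/
noncomputable def dULie : GroupLieAlgebra 𝓘(ℝ, E) G →ₗ⁅ℝ⁆ Module.End ℂ (U.smoothVectors E) where
  toFun x := U.dUOp x
  map_add' x y := by
    ext φ
    simp only [LinearMap.add_apply, Submodule.coe_add, coe_dUOp]
    exact (mfderiv 𝓘(ℝ, E) 𝓘(ℝ, H) (fun g : G ↦ U.op g (φ : H)) 1).map_add x y
  map_smul' c x := by
    ext φ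
    simp only [LinearMap.smul_apply, RingHom.id_apply, coe_dUOp]
    exact ((mfderiv 𝓘(ℝ, E) 𝓘(ℝ, H) (fun g : G ↦ U.op g (φ : H)) 1).map_smul c x).trans
      (congrArg (fun v : H ↦ c • v) (U.coe_dUOp x φ).symm)
  map_lie' := by
    intro x y
    ext φ
    rw [LieRing.of_associative_ring_bracket]
    exact U.lieDeriv_lie x y φ.2

/-- The infinitesimal representation `dU` of the enveloping algebra of the complexified Lie algebra
of `G` on `D^∞(U)`: the extension of `x ↦ dU(x)` to an algebra homomorphism. -/
noncomputable def dU : UniversalEnvelopingAlgebra ℂ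
    (TensorProduct ℝ ℂ (GroupLieAlgebra 𝓘(ℝ, E) G)) →ₐ[ℂ] Module.End ℂ (U.smoothVectors E) :=
  UniversalEnvelopingAlgebra.lift ℂ (complexifyLieHom U.dULie)

lemma dU_ι (c : ℂ) (x : GroupLieAlgebra 𝓘(ℝ, E) G) :
    U.dU (E := E) (UniversalEnvelopingAlgebra.ι ℂ (c ⊗ₜ[ℝ] x)) = c • U.dUOp x := by
  rw [dU, UniversalEnvelopingAlgebra.lift_ι_apply, complexifyLieHom_tmul]
  rfl

/-- The operator algebra `dU(𝓔(𝓖))` on `D^∞(U)`. -/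
noncomputable def dUAlgebra (E : Type*) [NormedAddCommGroup E] [NormedSpace ℝ E] [CompleteSpace E]
    {G : Type*} [TopologicalSpace G] [T2Space G] [ChartedSpace E G] [Group G]
    [LieGroup 𝓘(ℝ, E) ∞ G]
    {H : Type*} [NormedAddCommGroup H] [InnerProductSpace ℂ H] [CompleteSpace H]
    (U : UnitaryRep G H) : Subalgebra ℂ (Module.End ℂ (U.smoothVectors E)) :=
  (U.dU (E := E)).range

end Infinitesimal

end UnitaryRep

section Operators

variable {H : Type*} [NormedAddCommGroup H] [InnerProductSpace ℂ H] [CompleteSpace H]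

/-- A densely defined symmetric operator whose closure is self-adjoint. -/
def IsEssentiallySelfAdjoint (T : H →ₗ.[ℂ] H) : Prop :=
  Dense (T.domain : Set H) ∧ T.IsFormalAdjoint T ∧ IsSelfAdjoint T.closure

/-- An operator from the subspace `D` to itself, regarded as an operator in `H` with domain `D`. -/
def endToLinearPMap {D : Submodule ℂ H} (A : Module.End ℂ D) : H →ₗ.[ℂ] H where
  domain := D
  toFun := D.subtype ∘ₗ A

variable (H) in
/-- The index set of a fixed orthonormal basis of `H`. -/
def onbIndex : Set H := (exists_hilbertBasis ℂ H).choose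

variable (H) in
/-- A fixed orthonormal basis of `H`, used to compute traces (the trace of a positive operator and
the trace of a trace class operator do not depend on it). -/
noncomputable def onb : HilbertBasis (onbIndex H) ℂ H := (exists_hilbertBasis ℂ H).choose_spec.choose

/-- `T` is trace class: it is bounded, and `Tr |T| < ∞` with `|T| = √(T* T)`. -/
def IsTraceClass (T : H →ₗ[ℂ] H) : Prop :=
  ∃ S : H →L[ℂ] H, (S : H →ₗ[ℂ] H) = T ∧
    Summable fun i ↦ (⟪onb H i, CFC.abs S (onb H i)⟫_ℂ).re

/-- The trace of a trace class operator. -/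
noncomputable def opTrace (T : H →ₗ[ℂ] H) : ℂ := ∑' i, ⟪onb H i, T (onb H i)⟫_ℂ

/-- The everywhere defined product `A T`, where `A` is an operator on `D` and the range of `T` is
contained in `D`. -/
def mulOp {D : Submodule ℂ H} (A : Module.End ℂ D) (T : H →L[ℂ] H) (hT : ∀ v, T v ∈ D) :
    H →ₗ[ℂ] H :=
  D.subtype ∘ₗ A ∘ₗ (T : H →ₗ[ℂ] H).codRestrict D hT

/-- The set `𝓣₁(M)` of the trace class operators `T` with `T H ⊆ D`, `T* H ⊆ D` such that `A T` and
`A T*` are trace class for all `A ∈ M`. -/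
def traceClassOver {D : Submodule ℂ H} (M : Subalgebra ℂ (Module.End ℂ D)) : Set (H →L[ℂ] H) :=
  {T | IsTraceClass (T : H →ₗ[ℂ] H) ∧
    ∃ (h : ∀ v, T v ∈ D) (h' : ∀ v, ContinuousLinearMap.adjoint T v ∈ D),
      ∀ A ∈ M, IsTraceClass (mulOp A T h) ∧
        IsTraceClass (mulOp A (ContinuousLinearMap.adjoint T) h')}

/-- The state space of `M`: the positive (in particular self-adjoint) operators of trace one
in `𝓣₁(M)`. -/
structure StateSpace {D : Submodule ℂ H} (M : Subalgebra ℂ (Module.End ℂ D)) where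
  op : H →L[ℂ] H
  mem : op ∈ traceClassOver M
  isPositive : op.IsPositive
  trace_eq_one : opTrace (op : H →ₗ[ℂ] H) = 1

namespace StateSpace

variable {D : Submodule ℂ H} {M : Subalgebra ℂ (Module.End ℂ D)}

lemma op_apply_mem (ρ : StateSpace M) (v : H) : ρ.op v ∈ D := ρ.mem.2.choose v

/-- The function `a_Q(ρ) = Tr (A ρ)` on the state space. -/
noncomputable def aQ (A : M) (ρ : StateSpace M) : ℂ :=
  opTrace (mulOp (A : Module.End ℂ D) ρ.op ρ.op_apply_mem)

/-- The weak topology generated by the functions `a_Q`, `A ∈ M`. -/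
noncomputable instance : TopologicalSpace (StateSpace M) :=
  ⨅ A : M, TopologicalSpace.induced (aQ A) inferInstance

/-- The qr-number `a_Q(W)`: the function `ρ ↦ Tr (A ρ)` on the set `W` of states. -/
noncomputable def qrNumber (A : M) (W : Set (StateSpace M)) : W → ℂ := fun ρ ↦ aQ A ρ

end StateSpace

end Operators

/-! Perturb a state inside the open set by a small admixture of a vector state. Fix ρ in W and a
unit vector φ in the domain D. The mixture (1 - t) ρ + t |φ⟩⟨φ| is again a state, and Tr (B ·) takes
on it the value (1 - t) Tr (B ρ) + t ⟨φ, B φ⟩ for every B in M (`aQ_mix`). This is affine in t, so t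
↦ mixture is continuous for the weak topology, and the mixture stays in W for some t > 0. As Tr (A
·) vanishes at ρ and at this mixture, t ⟨φ, A φ⟩ = 0, hence ⟨φ, A φ⟩ = 0. Over ℂ, polarization then
forces A = 0.

The analytic cost lies in showing that the mixture belongs to the state space and that the trace is
additive. The definition by summability of the diagonal of |T| behaves badly under sums, |S + T|
being unrelated to |S| + |T|. `isTraceClass_iff` replaces it by a condition linear in T, at the
price of polar decomposition and the factorization of trace class operators into Hilbert–Schmidt
ones. -/

section TraceClass

open ContinuousLinearMap

/-! ### Hilbert–Schmidt sums and polar decomposition -/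

section

variable {ι H : Type*} [NormedAddCommGroup H] [InnerProductSpace ℂ H]

/-- Parseval's identity. -/
lemma HilbertBasis.hasSum_norm_inner_sq (b : HilbertBasis ι ℂ H) (x : H) :
    HasSum (fun i ↦ ‖⟪b i, x⟫_ℂ‖ ^ 2) (‖x‖ ^ 2) := by
  have h := (b.hasSum_inner_mul_inner x x).mapL Complex.reCLM
  have h2 : ∀ i, Complex.reCLM (⟪x, b i⟫_ℂ * ⟪b i, x⟫_ℂ) = ‖⟪b i, x⟫_ℂ‖ ^ 2 := fun i ↦ by
    rw [← inner_conj_symm x (b i), Complex.conj_mul']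
    norm_cast
  simp only [h2] at h
  have h3 : Complex.reCLM ⟪x, x⟫_ℂ = ‖x‖ ^ 2 := inner_self_eq_norm_sq (𝕜 := ℂ) x
  rwa [h3] at h

lemma HilbertBasis.summable_norm_sq_comp (b : HilbertBasis ι ℂ H) {R : H →L[ℂ] H}
    (hR : Summable fun i ↦ ‖R (b i)‖ ^ 2) (V : H →L[ℂ] H) :
    Summable fun i ↦ ‖(V ∘L R) (b i)‖ ^ 2 := by
  refine Summable.of_nonneg_of_le (fun _ ↦ by positivity) (fun i ↦ ?_) (hR.mul_left (‖V‖ ^ 2))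
  rw [← mul_pow]
  gcongr
  exact V.le_opNorm _

lemma summable_inner_of_summable_norm_sq {f g : ι → H} (hf : Summable fun i ↦ ‖f i‖ ^ 2)
    (hg : Summable fun i ↦ ‖g i‖ ^ 2) : Summable fun i ↦ ⟪f i, g i⟫_ℂ := by
  refine Summable.of_norm_bounded (hf.add hg) fun i ↦ ?_
  nlinarith [norm_inner_le_norm (𝕜 := ℂ) (f i) (g i), sq_nonneg (‖f i‖ - ‖g i‖),
    norm_nonneg (f i), norm_nonneg (g i)]

variable [CompleteSpace H]

/-- The adjoint of a Hilbert–Schmidt operator is Hilbert–Schmidt. -/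
lemma HilbertBasis.summable_norm_sq_adjoint (b : HilbertBasis ι ℂ H) {R : H →L[ℂ] H}
    (hR : Summable fun i ↦ ‖R (b i)‖ ^ 2) : Summable fun i ↦ ‖adjoint R (b i)‖ ^ 2 := by
  -- The squared moduli of the matrix entries of `R` are summable over pairs; exchanging the two
  -- indices sums the same entries by rows, that is, along the adjoint.
  have h1 : Summable fun p : ι × ι ↦ ‖⟪b p.2, R (b p.1)⟫_ℂ‖ ^ 2 := by
    refine (summable_prod_of_nonneg fun _ ↦ by positivity).2
      ⟨fun i ↦ (b.hasSum_norm_inner_sq (R (b i))).summable, ?_⟩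
    simpa only [(b.hasSum_norm_inner_sq _).tsum_eq] using hR
  have h2 := ((summable_prod_of_nonneg fun _ ↦ by positivity).1 h1.prod_symm).2
  refine h2.congr fun j ↦ ?_
  rw [← (b.hasSum_norm_inner_sq (adjoint R (b j))).tsum_eq]
  refine tsum_congr fun i ↦ ?_
  rw [adjoint_inner_right, ← inner_conj_symm, RCLike.norm_conj]
  rfl

/-- From |S|² = S* S. Hence |S| x ↦ S x is well defined and isometric on the range of |S|, the germ
of the polar decomposition. -/
lemma norm_cfcAbs_apply (S : H →L[ℂ] H) (x : H) : ‖CFC.abs S x‖ = ‖S x‖ := by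
  have h0 : adjoint (CFC.abs S) = CFC.abs S :=
    (CFC.abs_nonneg S).isSelfAdjoint
  have h1 : ⟪CFC.abs S x, CFC.abs S x⟫_ℂ = ⟪S x, S x⟫_ℂ := by
    have h2 : CFC.abs S (CFC.abs S x) = adjoint S (S x) :=
      congrArg (fun T : H →L[ℂ] H ↦ T x) (CFC.abs_mul_abs S)
    rw [← adjoint_inner_right, h0, h2, adjoint_inner_right]
  rw [inner_self_eq_norm_sq_to_K, inner_self_eq_norm_sq_to_K] at h1
  exact (sq_eq_sq₀ (norm_nonneg _) (norm_nonneg _)).1 (by exact_mod_cast h1)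

/-- A positive operator has a self-adjoint square root. -/
lemma exists_selfAdjoint_sqrt {S : H →L[ℂ] H} (hS : 0 ≤ S) :
    ∃ R : H →L[ℂ] H, adjoint R = R ∧ ∀ x, R (R x) = S x :=
  ⟨CFC.sqrt S, (CFC.sqrt_nonneg S).isSelfAdjoint,
    fun x ↦ congrArg (fun T : H →L[ℂ] H ↦ T x) (CFC.sqrt_mul_sqrt_self S hS)⟩

/-- Polar decomposition of a bounded operator. -/
lemma exists_polar_decomposition (S : H →L[ℂ] H) :
    ∃ V : H →L[ℂ] H, V ∘L CFC.abs S = S ∧ adjoint V ∘L S = CFC.abs S := by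
  -- The partial isometry is |S| x ↦ S x, extended by continuity to the closure `K` of the range of
  -- |S| and by zero to the orthogonal complement.
  set K : Submodule ℂ H := (LinearMap.range (CFC.abs S).toLinearMap).topologicalClosure
  have hmem (x : H) : CFC.abs S x ∈ K := Submodule.le_topologicalClosure _ ⟨x, rfl⟩
  have : CompleteSpace K := (Submodule.isClosed_topologicalClosure _).completeSpace_coe
  let e : H →ₗ[ℂ] K := (CFC.abs S).toLinearMap.codRestrict K hmem
  have he : DenseRange e := by
    intro y
    rw [closure_subtype]
    have h : ((↑) '' Set.range e : Set H) = LinearMap.range (CFC.abs S).toLinearMap := by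
      ext z
      simp [e]
    rw [h, ← Submodule.topologicalClosure_coe]
    exact y.2
  have hn (x : H) : ‖(S : H →ₗ[ℂ] H) x‖ ≤ 1 * ‖e x‖ := by
    rw [one_mul]
    exact (norm_cfcAbs_apply S x).ge
  let V₀ : K →L[ℂ] H := (S : H →ₗ[ℂ] H).extendOfNorm e
  have hV₀ (k : K) : ‖V₀ k‖ ≤ ‖k‖ := by
    simpa using LinearMap.norm_extendOfNorm_apply_le he 1 hn k
  let V : H →L[ℂ] H := V₀ ∘L K.orthogonalProjectionOnto
  have hVn (x : H) : ‖V x‖ ≤ ‖x‖ := (hV₀ _).trans (K.norm_orthogonalProjectionOnto_apply_le x)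
  have hVS (x : H) : V (CFC.abs S x) = S x := by
    have h1 : K.orthogonalProjectionOnto (CFC.abs S x) = e x :=
      K.orthogonalProjectionOnto_mem_subspace_eq_self (e x)
    change V₀ (K.orthogonalProjectionOnto (CFC.abs S x)) = S x
    rw [h1]
    exact LinearMap.extendOfNorm_eq he ⟨1, hn⟩ x
  have hVa : ‖adjoint V‖ ≤ 1 := by
    rw [LinearIsometryEquiv.norm_map]
    exact V.opNorm_le_bound zero_le_one (by simpa using hVn)
  refine ⟨V, ContinuousLinearMap.ext hVS, ContinuousLinearMap.ext fun x ↦ ?_⟩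
  -- For V* S = |S| it suffices that V is a contraction with V |S| = S: expanding ‖V* S x - |S| x‖²,
  -- the cross term is -2 ‖S x‖² and the two squares are at most ‖S x‖² each.
  rw [comp_apply, ← sub_eq_zero, ← norm_eq_zero]
  have h1 := @norm_sub_sq ℂ H _ _ _ (adjoint V (S x)) (CFC.abs S x)
  rw [adjoint_inner_left, hVS, inner_self_eq_norm_sq, norm_cfcAbs_apply] at h1
  have h2 : ‖adjoint V (S x)‖ ≤ ‖S x‖ := by
    simpa using (adjoint V).le_of_opNorm_le hVa (S x)
  have h3 : ‖adjoint V (S x)‖ ^ 2 ≤ ‖S x‖ ^ 2 := by gcongr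
  nlinarith [sq_nonneg ‖adjoint V (S x) - CFC.abs S x‖]

/-- With S = P |S| and R = |S|^(1/2), V S = (V P R) R is a product of two Hilbert–Schmidt operators:
the diagonal of |S| consists of the ‖R b_i‖². The diagonal entries of V S are then ⟨(V P R)* b_i, R
b_i⟩, inner products of two square-summable families. -/
lemma HilbertBasis.summable_inner_comp_of_summable_abs (b : HilbertBasis ι ℂ H) {S : H →L[ℂ] H}
    (h : Summable fun i ↦ (⟪b i, CFC.abs S (b i)⟫_ℂ).re) (V : H →L[ℂ] H) :
    Summable fun i ↦ ⟪b i, V (S (b i))⟫_ℂ := by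
  obtain ⟨R, hRa, hRR⟩ := exists_selfAdjoint_sqrt (CFC.abs_nonneg S)
  have hHS : Summable fun i ↦ ‖R (b i)‖ ^ 2 := by
    refine h.congr fun i ↦ ?_
    have h1 : ⟪b i, R (R (b i))⟫_ℂ = ⟪R (b i), R (b i)⟫_ℂ := by
      rw [← adjoint_inner_left, hRa]
    rw [← hRR, h1]
    exact inner_self_eq_norm_sq (𝕜 := ℂ) (R (b i))
  obtain ⟨P, hP, -⟩ := exists_polar_decomposition S
  have h1 := b.summable_norm_sq_adjoint (b.summable_norm_sq_comp hHS (V ∘L P))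
  refine (summable_inner_of_summable_norm_sq h1 hHS).congr fun i ↦ ?_
  have h2 : P (CFC.abs S (b i)) = S (b i) := congrArg (fun T : H →L[ℂ] H ↦ T (b i)) hP
  rw [adjoint_inner_left, comp_apply, hRR, comp_apply, h2]

end

/-! ### Trace class operators and linearity of the trace -/

variable {H : Type*} [NormedAddCommGroup H] [InnerProductSpace ℂ H] [CompleteSpace H]

/-- Trace class operators are the bounded operators all of whose bounded left multiples have
summable diagonals. -/
lemma isTraceClass_iff {T : H →ₗ[ℂ] H} : IsTraceClass T ↔ ∃ S : H →L[ℂ] H,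
    (S : H →ₗ[ℂ] H) = T ∧ ∀ V : H →L[ℂ] H, Summable fun i ↦ ⟪onb H i, V (S (onb H i))⟫_ℂ := by
  refine exists_congr fun S ↦ and_congr_right fun _ ↦ ⟨fun h V ↦ ?_, fun h ↦ ?_⟩
  · exact (onb H).summable_inner_comp_of_summable_abs h V
  · obtain ⟨P, -, hP⟩ := exists_polar_decomposition S
    -- The multiplier P* recovers the diagonal of |S|, since P* S = |S|.
    refine ((h (adjoint P)).mapL Complex.reCLM).congr fun i ↦ ?_
    rw [← comp_apply, hP]
    rfl

namespace IsTraceClass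

lemma add {S T : H →ₗ[ℂ] H} (hS : IsTraceClass S) (hT : IsTraceClass T) :
    IsTraceClass (S + T) := by
  obtain ⟨S, rfl, hS'⟩ := isTraceClass_iff.1 hS
  obtain ⟨T, rfl, hT'⟩ := isTraceClass_iff.1 hT
  refine isTraceClass_iff.2 ⟨S + T, rfl, fun V ↦ ((hS' V).add (hT' V)).congr fun i ↦ ?_⟩
  simp

lemma smul {T : H →ₗ[ℂ] H} (hT : IsTraceClass T) (c : ℂ) : IsTraceClass (c • T) := by
  obtain ⟨T, rfl, hT'⟩ := isTraceClass_iff.1 hT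
  refine isTraceClass_iff.2 ⟨c • T, rfl, fun V ↦ ((hT' V).mul_left c).congr fun i ↦ ?_⟩
  simp

lemma summable_inner {T : H →ₗ[ℂ] H} (hT : IsTraceClass T) :
    Summable fun i ↦ ⟪onb H i, T (onb H i)⟫_ℂ := by
  obtain ⟨T, rfl, hT'⟩ := isTraceClass_iff.1 hT
  exact hT' (.id ℂ H)

end IsTraceClass

/-- The diagonal of V |φ⟩⟨ψ| has entries ⟨ψ, b_i⟩ ⟨b_i, V φ⟩, summable as a Parseval expansion. Two
different vectors are needed because B |φ⟩⟨φ| = |B φ⟩⟨φ|. -/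
lemma isTraceClass_rankOne (φ ψ : H) :
    IsTraceClass (InnerProductSpace.rankOne ℂ φ ψ : H →ₗ[ℂ] H) := by
  refine isTraceClass_iff.2 ⟨_, rfl, fun V ↦
    ((onb H).summable_inner_mul_inner ψ (V φ)).congr fun i ↦ ?_⟩
  simp

/-- Summability matters here: `tsum` defaults to zero on a divergent family, so additivity can fail
without it. -/
lemma opTrace_add {S T : H →ₗ[ℂ] H} (hS : IsTraceClass S) (hT : IsTraceClass T) :
    opTrace (S + T) = opTrace S + opTrace T := by
  rw [opTrace, opTrace, opTrace, ← hS.summable_inner.tsum_add hT.summable_inner]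
  simp

lemma opTrace_smul (c : ℂ) (T : H →ₗ[ℂ] H) : opTrace (c • T) = c * opTrace T := by
  simp [opTrace, tsum_mul_left]

lemma opTrace_rankOne (φ ψ : H) :
    opTrace (InnerProductSpace.rankOne ℂ φ ψ : H →ₗ[ℂ] H) = ⟪ψ, φ⟫_ℂ := by
  rw [← (onb H).tsum_inner_mul_inner ψ φ]
  simp [opTrace]

end TraceClass

/-! ### Mixing a state with a vector state -/

namespace StateSpace

open InnerProductSpace ComplexOrder

variable {H : Type*} [NormedAddCommGroup H] [InnerProductSpace ℂ H]
  {D : Submodule ℂ H}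

/-- The identity B |φ⟩⟨φ| = |B φ⟩⟨φ| keeps the perturbation of rank at most one even when B is
unbounded. The range condition `h` is left arbitrary, so the identity applies to whichever proof a
state carries. -/
lemma mulOp_smul_add_smul_rankOne (B : Module.End ℂ D) (a c : ℂ) {T : H →L[ℂ] H}
    (hT : ∀ v, T v ∈ D) (φ : D) (h : ∀ v, (a • T + c • rankOne ℂ (φ : H) (φ : H)) v ∈ D) :
    mulOp B (a • T + c • rankOne ℂ (φ : H) (φ : H)) h =
      a • mulOp B T hT + c • (rankOne ℂ (B φ : H) (φ : H) : H →ₗ[ℂ] H) := by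
  ext v
  have h1 : (⟨_, h v⟩ : D) = a • ⟨T v, hT v⟩ + (c * ⟪(φ : H), v⟫_ℂ) • φ := by
    ext
    simp [mul_smul]
  change ((B ⟨_, h v⟩ : D) : H) = a • (B ⟨T v, hT v⟩ : H) + c • ⟪(φ : H), v⟫_ℂ • (B φ : H)
  rw [h1, map_add, map_smul, map_smul]
  simp [mul_smul]

variable [CompleteSpace H] {M : Subalgebra ℂ (Module.End ℂ D)}

lemma isTraceClass_mulOp (ρ : StateSpace M) {B : Module.End ℂ D} (hB : B ∈ M) :
    IsTraceClass (mulOp B ρ.op ρ.op_apply_mem) := by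
  obtain ⟨-, _, _, hT⟩ := ρ.mem
  exact (hT B hB).1

/-- The mixture `(1 - t) ρ + t |φ⟩⟨φ|` of a state `ρ` and the vector state of the unit
vector `φ`. -/
noncomputable def mix (ρ : StateSpace M) (φ : D) (hφ : ‖(φ : H)‖ = 1) (t : unitInterval) :
    StateSpace M :=
  let T : H →L[ℂ] H := ((1 - t : ℝ) : ℂ) • ρ.op + ((t : ℝ) : ℂ) • rankOne ℂ (φ : H) (φ : H)
  have hT : ∀ v, T v ∈ D := fun v ↦
    D.add_mem (D.smul_mem _ (ρ.op_apply_mem v)) (D.smul_mem _ (D.smul_mem _ φ.2))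
  have hpos : T.IsPositive := by
    rw [← ContinuousLinearMap.nonneg_iff_isPositive]
    refine add_nonneg (smul_nonneg ?_ (ρ.op.nonneg_iff_isPositive.2 ρ.isPositive))
      (smul_nonneg ?_ (ContinuousLinearMap.nonneg_iff_isPositive _ |>.2 (isPositive_rankOne_self _)))
    · exact_mod_cast sub_nonneg.2 t.2.2
    · exact_mod_cast t.2.1
  have hadj : ContinuousLinearMap.adjoint T = T := hpos.isSelfAdjoint
  have htc : ∀ B ∈ M, IsTraceClass (mulOp B T hT) := fun B hB ↦ by
    rw [mulOp_smul_add_smul_rankOne B _ _ ρ.op_apply_mem]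
    exact ((ρ.isTraceClass_mulOp hB).smul _).add ((isTraceClass_rankOne _ _).smul _)
  { op := T
    mem := by
      refine ⟨(ρ.mem.1.smul _).add ((isTraceClass_rankOne _ _).smul _), hT, by rwa [hadj],
        fun B hB ↦ ⟨htc B hB, ?_⟩⟩
      -- T is self-adjoint, so the condition on B T* is the one on B T.
      simp only [hadj]
      exact htc B hB
    isPositive := hpos
    trace_eq_one := by
      change opTrace (((1 - t : ℝ) : ℂ) • (ρ.op : H →ₗ[ℂ] H) +
        ((t : ℝ) : ℂ) • (rankOne ℂ (φ : H) (φ : H) : H →ₗ[ℂ] H)) = 1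
      rw [opTrace_add (ρ.mem.1.smul _) ((isTraceClass_rankOne _ _).smul _), opTrace_smul,
        opTrace_smul, ρ.trace_eq_one, opTrace_rankOne, inner_self_eq_norm_sq_to_K, hφ]
      push_cast
      ring }

lemma aQ_mix (B : M) (ρ : StateSpace M) (φ : D) (hφ : ‖(φ : H)‖ = 1) (t : unitInterval) :
    aQ B (ρ.mix φ hφ t) =
      ((1 - t : ℝ) : ℂ) * aQ B ρ + ((t : ℝ) : ℂ) * ⟪(φ : H), (B : Module.End ℂ D) φ⟫_ℂ := by
  have h := mulOp_smul_add_smul_rankOne (B : Module.End ℂ D) ((1 - t : ℝ) : ℂ) ((t : ℝ) : ℂ)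
    ρ.op_apply_mem φ (ρ.mix φ hφ t).op_apply_mem
  refine (congrArg opTrace h).trans ?_
  rw [opTrace_add ((ρ.isTraceClass_mulOp B.2).smul _) ((isTraceClass_rankOne _ _).smul _),
    opTrace_smul, opTrace_smul, opTrace_rankOne, aQ]

/-- Continuity into the weak topology is tested on each Tr (B ·) separately, and along the segment
each of these is affine in t. -/
lemma continuous_mix (ρ : StateSpace M) (φ : D) (hφ : ‖(φ : H)‖ = 1) :
    Continuous (ρ.mix φ hφ) := by
  refine continuous_iInf_rng.2 fun B ↦ continuous_induced_rng.2 ?_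
  have h : aQ B ∘ ρ.mix φ hφ = fun t : unitInterval ↦
      ((1 - t : ℝ) : ℂ) * aQ B ρ + ((t : ℝ) : ℂ) * ⟪(φ : H), (B : Module.End ℂ D) φ⟫_ℂ :=
    funext (aQ_mix B ρ φ hφ)
  rw [h]
  fun_prop

lemma mix_zero (ρ : StateSpace M) (φ : D) (hφ : ‖(φ : H)‖ = 1) : ρ.mix φ hφ 0 = ρ := by
  have h : (ρ.mix φ hφ 0).op = ρ.op := by simp [mix]
  -- The other fields of a state are propositions, so equality of the operators is enough.
  generalize ρ.mix φ hφ 0 = σ at h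
  cases ρ
  cases σ
  cases h
  rfl

/-- If `Tr (A ρ)` vanishes on a nonempty open set of states, all diagonal matrix elements of `A`
at unit vectors vanish. -/
lemma inner_eq_zero_of_qrNumber_eq_zero {A : M} {W : Set (StateSpace M)} (hWo : IsOpen W)
    (hWne : W.Nonempty) (hW : qrNumber A W = 0) (φ : D) (hφ : ‖(φ : H)‖ = 1) :
    ⟪(φ : H), (A : Module.End ℂ D) φ⟫_ℂ = 0 := by
  obtain ⟨ρ, hρ⟩ := hWne
  have hA (σ : StateSpace M) (hσ : σ ∈ W) : aQ A σ = 0 := congrFun hW ⟨σ, hσ⟩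
  -- A sequence of positive parameters tending to 0: some 1 / (n + 1) falls in the neighbourhood of
  -- 0 on which the mixture stays in `W`.
  let s : ℕ → unitInterval := fun n ↦ ⟨1 / ((n : ℝ) + 1), by positivity,
    by rw [div_le_one (by positivity)]; linarith [n.cast_nonneg (α := ℝ)]⟩
  have hs : Filter.Tendsto s Filter.atTop (nhds 0) :=
    tendsto_subtype_rng.2 tendsto_one_div_add_atTop_nhds_zero_nat
  have h0 : ρ.mix φ hφ ⁻¹' W ∈ nhds (0 : unitInterval) :=
    (hWo.preimage (ρ.continuous_mix φ hφ)).mem_nhds (by rwa [Set.mem_preimage, mix_zero])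
  obtain ⟨n, hn⟩ := (hs.eventually_mem h0).exists
  have h1 := aQ_mix A ρ φ hφ (s n)
  -- Both the mixture and ρ lie in `W`, which leaves 0 = t ⟨φ, A φ⟩ with t ≠ 0.
  rw [hA _ hn, hA _ hρ, mul_zero, zero_add] at h1
  refine (mul_eq_zero.1 h1.symm).resolve_left ?_
  have : (1 / ((n : ℝ) + 1)) ≠ 0 := by positivity
  exact Complex.ofReal_ne_zero.2 this

end StateSpace

/-! ### Polarization and conclusion -/

/-- An operator on a subspace whose diagonal matrix elements at unit vectors vanish is zero. -/
lemma Module.End.eq_zero_of_inner_eq_zero {H : Type*} [NormedAddCommGroup H]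
    [InnerProductSpace ℂ H] {D : Submodule ℂ H} (A : Module.End ℂ D)
    (h : ∀ φ : D, ‖(φ : H)‖ = 1 → ⟪(φ : H), A φ⟫_ℂ = 0) : A = 0 := by
  -- Complex polarization in the inner product space `D`: the quadratic form determines the
  -- operator, which fails over ℝ. Rescaling reduces its vanishing to unit vectors.
  refine inner_map_self_eq_zero A |>.1 fun φ ↦ ?_
  rcases eq_or_ne φ 0 with rfl | hφ
  · simp
  have h1 := h ((‖φ‖⁻¹ : ℂ) • φ) (by simpa using norm_smul_inv_norm (𝕜 := ℂ) hφ)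
  rw [map_smul, Submodule.coe_smul, Submodule.coe_smul, inner_smul_left, inner_smul_right] at h1
  have h2 := (mul_eq_zero.1 ((mul_eq_zero.1 h1).resolve_left
    (by simpa using hφ))).resolve_left (by simpa using hφ)
  rw [Submodule.coe_inner, ← inner_conj_symm, h2, map_zero]

theorem proposition13 {n : ℕ}
    {G : Type*} [TopologicalSpace G] [T2Space G] [ChartedSpace (EuclideanSpace ℝ (Fin n)) G]
    [Group G] [LieGroup 𝓘(ℝ, EuclideanSpace ℝ (Fin n)) ∞ G]
    {H : Type*} [NormedAddCommGroup H] [InnerProductSpace ℂ H] [CompleteSpace H]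
    [TopologicalSpace.SeparableSpace H]
    (U : UnitaryRep G H)
    (A : U.dUAlgebra (EuclideanSpace ℝ (Fin n)))
    (hA : IsEssentiallySelfAdjoint
      (endToLinearPMap (A : Module.End ℂ (U.smoothVectors (EuclideanSpace ℝ (Fin n))))))
    (W : Set (StateSpace (U.dUAlgebra (EuclideanSpace ℝ (Fin n)))))
    (hWopen : IsOpen W) (hWne : W.Nonempty)
    (hW : StateSpace.qrNumber A W = 0) :
    (A : Module.End ℂ (U.smoothVectors (EuclideanSpace ℝ (Fin n)))) = 0 :=
  Module.End.eq_zero_of_inner_eq_zero _ (StateSpace.inner_eq_zero_of_qrNumber_eq_zero hWopen hWne hW)
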